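/- Notation. Let $d, r, s \in \mathbb{N}_0$ and let $\mathbb{R}^d$ carry the Euclidean norm $|\cdot|$. $\mathbb{T}^p$ is the space of symmetric $p$-tensors over $\mathbb{R}^d$, i.e. symmetric multilinear maps $(\mathbb{R}^d)^p \to \mathbb{R}$, with the norm $|T| = \sup\{|T(v_1,\dots,v_p)| : |v_1| = \dots = |v_p| = 1\}$; $x^r y^s \in \mathbb{T}^{r+s}$ is the symmetric tensor product (the symmetrization of the tensor product) of $r$ copies of $x$ and $s$ copies of $y$. For a nonempty compact set $K \subseteq \mathbb{R}^d$ and $R > 0$ let $K^R$ be the set of points at distance at most $R$ from $K$, and let $p_K(x)$ be the point of $K$ closest to $x$, which is unique for almost every $x$. The Voronoi tensor measure of $K$ is the $\mathbb{T}^{r+s}$-valued measure given on Borel sets $A \subseteq \mathbb{R}^d$ by $$\mathcal{V}_R^{r,s}(K;A) = \int_{K^R} \mathbf{1}_A(p_K(x))\, p_K(x)^r (x - p_K(x))^s\, dx .$$ The bounded Lipschitz distance of two $\mathbb{T}^p$-valued bounded Borel measures is $$d_{bL}(\mu,\nu) = \sup\Big\{ \Big| \int f\, d\mu - \int f\, d\nu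 \Big| : f : \mathbb{R}^d \to \mathbb{R},\ |f|_L + |f|_\infty \le 1 \Big\},$$ where $|f|_\infty$ is the supremum norm and $|f|_L = \sup\{ |f(x)-f(y)|/|x-y| : x \ne y\}$. Let $d_H$ be the Hausdorff distance and $B(0,\rho)$ the closed ball of radius $\rho$ about the origin. Theorem. Let $R, \rho > 0$ and $r, s \in \mathbb{N}_0$. Then there is a constant $C_2 = C_2(d,R,\rho,r,s) > 0$ such that $$d_{bL}\big(\mathcal{V}_R^{r,s}(K;\cdot), \mathcal{V}_R^{r,s}(K_0;\cdot)\big) \le C_2\, d_H(K,K_0)^{1/2}$$ for all nonempty compact sets $K, K_0 \subseteq B(0,\rho)$. -/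

import Mathlib

open MeasureTheory
open scoped ENNReal

noncomputable section

namespace VoronoiTensor

/-- Euclidean space `ℝ^d` with its standard inner product. -/
abbrev E (d : ℕ) : Type := EuclideanSpace ℝ (Fin d)

/-! ### Symmetric tensors -/

/-- The symmetric `p`-tensors over `ℝ^d`, seen as the symmetric multilinear maps
`(ℝ^d)^p → ℝ` (continuity is automatic in finite dimension), as a subspace of all multilinear
maps. -/
def symTensorSubmodule (d p : ℕ) :
    Submodule ℝ (ContinuousMultilinearMap ℝ (fun _ : Fin p => E d) ℝ) where
  carrier := {T | ∀ (σ : Equiv.Perm (Fin p)) (v : Fin p → E d), T (v ∘ σ) = T v}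
  zero_mem' := by intro σ v; simp
  add_mem' := by
    intro S T hS hT σ v
    simp [hS σ v, hT σ v]
  smul_mem' := by
    intro c T hT σ v
    simp [hT σ v]

/-- The space `𝕋^p` of symmetric `p`-tensors over `ℝ^d`.  Its norm is the operator norm of
multilinear maps, which is `sup {|T(v₁,…,v_p)| : |v₁| = … = |v_p| = 1}`,
see `SymTensor.isLeast_norm`. -/
def SymTensor (d p : ℕ) : Type := symTensorSubmodule d p

instance (d p : ℕ) : NormedAddCommGroup (SymTensor d p) :=
  inferInstanceAs (NormedAddCommGroup (symTensorSubmodule d p))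

instance (d p : ℕ) : NormedSpace ℝ (SymTensor d p) :=
  inferInstanceAs (NormedSpace ℝ (symTensorSubmodule d p))

/-- The multilinear map underlying a symmetric tensor. -/
def SymTensor.toMultilinear {d p : ℕ} :
    SymTensor d p →ₗᵢ[ℝ] ContinuousMultilinearMap ℝ (fun _ : Fin p => E d) ℝ :=
  (symTensorSubmodule d p).subtypeₗᵢ

theorem isClosed_symTensorSubmodule (d p : ℕ) :
    IsClosed (symTensorSubmodule d p :
      Set (ContinuousMultilinearMap ℝ (fun _ : Fin p => E d) ℝ)) := by
  have : (symTensorSubmodule d p : Set (ContinuousMultilinearMap ℝ (fun _ : Fin p => E d) ℝ))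
      = ⋂ (σ : Equiv.Perm (Fin p)) (v : Fin p → E d), {T | T (v ∘ σ) = T v} := by
    ext T; simp [symTensorSubmodule]
  rw [this]
  exact isClosed_iInter fun σ => isClosed_iInter fun v =>
    isClosed_eq (ContinuousMultilinearMap.apply ℝ (fun _ : Fin p => E d) ℝ (v ∘ σ)).continuous
      (ContinuousMultilinearMap.apply ℝ (fun _ : Fin p => E d) ℝ v).continuous

instance (d p : ℕ) : CompleteSpace (SymTensor d p) :=
  (isClosed_symTensorSubmodule d p).completeSpace_coe

/-- The norm of a symmetric tensor is the least upper bound (within `[0,∞)`) of the absolute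
values of its evaluations at unit vectors. -/
theorem SymTensor.isLeast_norm {d p : ℕ} (T : SymTensor d p) :
    IsLeast {c : ℝ | 0 ≤ c ∧ ∀ v : Fin p → E d, (∀ i, ‖v i‖ = 1) → |SymTensor.toMultilinear T v| ≤ c} ‖T‖ := by
  rw [← SymTensor.toMultilinear.norm_map]
  refine ⟨⟨norm_nonneg _, fun v hv => ?_⟩, fun c hc => ?_⟩
  · have := (SymTensor.toMultilinear T).le_opNorm v
    simpa [hv] using this
  · refine (SymTensor.toMultilinear T).opNorm_le_bound hc.1 fun m => ?_
    by_cases h : ∃ i, m i = 0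
    · obtain ⟨i, hi⟩ := h
      rw [(SymTensor.toMultilinear T).map_coord_zero i hi, norm_zero]
      exact mul_nonneg hc.1 (Finset.prod_nonneg fun _ _ => norm_nonneg _)
    · push Not at h
      have hn : ∀ i, ‖m i‖ ≠ 0 := fun i => norm_ne_zero_iff.2 (h i)
      have h1 := hc.2 (fun i => ‖m i‖⁻¹ • m i) fun i => by
        rw [norm_smul, norm_inv, norm_norm, inv_mul_cancel₀ (hn i)]
      have h2 : (SymTensor.toMultilinear T) m = (∏ i, ‖m i‖) * (SymTensor.toMultilinear T) (fun i => ‖m i‖⁻¹ • m i) := by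
        rw [← smul_eq_mul, ← ContinuousMultilinearMap.map_smul_univ]
        congr 1
        ext1 i
        rw [smul_smul, mul_inv_cancel₀ (hn i), one_smul]
      rw [h2, norm_mul, Real.norm_of_nonneg (Finset.prod_nonneg fun _ _ => norm_nonneg _),
        mul_comm]
      exact mul_le_mul_of_nonneg_right h1 (Finset.prod_nonneg fun _ _ => norm_nonneg _)

/-- The tensor product `y₁ ⊗ ⋯ ⊗ y_m`, i.e. `(v₁,…,v_m) ↦ ⟨y₁,v₁⟩ ⋯ ⟨y_m,v_m⟩`. -/
def tensorProd {d m : ℕ} (y : Fin m → E d) :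
    ContinuousMultilinearMap ℝ (fun _ : Fin m => E d) ℝ :=
  (ContinuousMultilinearMap.mkPiAlgebra ℝ (Fin m) ℝ).compContinuousLinearMap
    fun i => innerSL ℝ (y i)

theorem tensorProd_apply {d m : ℕ} (y v : Fin m → E d) :
    tensorProd y v = ∏ i, inner ℝ (y i) (v i) := by
  simp [tensorProd]

/-- The symmetric tensor product
`y₁ ⊙ ⋯ ⊙ y_m = (m!)⁻¹ ∑_σ y_{σ(1)} ⊗ ⋯ ⊗ y_{σ(m)}`. -/
def symProd {d m : ℕ} (y : Fin m → E d) : SymTensor d m :=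
  ⟨((m.factorial : ℝ)⁻¹) • ∑ σ : Equiv.Perm (Fin m), tensorProd (y ∘ σ), by
    intro τ v
    simp only [smul_apply, sum_apply, tensorProd_apply, Function.comp_apply]
    congr 1
    refine Fintype.sum_equiv (Equiv.mulRight τ⁻¹) _ _ fun σ => ?_
    refine Fintype.prod_equiv τ _ _ fun i => ?_
    simp⟩

/-- The symmetric tensor `x^r y^s`, i.e. the symmetric tensor product of `r` copies of `x` and
`s` copies of `y`. -/
def powProd {d : ℕ} (r s : ℕ) (x y : E d) : SymTensor d (r + s) :=
  symProd (Fin.append (fun _ : Fin r => x) (fun _ : Fin s => y))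

/-! ### The metric projection -/

theorem exists_nearest {d : ℕ} (K : TopologicalSpace.NonemptyCompacts (E d)) (x : E d) :
    ∃ p ∈ (K : Set (E d)), dist x p = Metric.infDist x (K : Set (E d)) := by
  obtain ⟨p, hp, h⟩ := K.isCompact.exists_infDist_eq_dist K.nonempty x
  exact ⟨p, hp, h.symm⟩

/-- The metric projection `p_K`: `metricProj K x` is a point of `K` closest to `x`.  The closest
point is unique for Lebesgue almost every `x` (`ae_eq_metricProj`); on the exceptional null set
some closest point is chosen. -/
def metricProj {d : ℕ} (K : TopologicalSpace.NonemptyCompacts (E d)) (x : E d) : E d :=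
  (exists_nearest K x).choose

theorem metricProj_mem {d : ℕ} (K : TopologicalSpace.NonemptyCompacts (E d)) (x : E d) :
    metricProj K x ∈ (K : Set (E d)) :=
  (exists_nearest K x).choose_spec.1

theorem dist_metricProj {d : ℕ} (K : TopologicalSpace.NonemptyCompacts (E d)) (x : E d) :
    dist x (metricProj K x) = Metric.infDist x (K : Set (E d)) :=
  (exists_nearest K x).choose_spec.2

/-- Where `d_K²` is differentiable, its gradient determines the closest point. -/
theorem nearest_eq_of_differentiableAt {d : ℕ} (K : TopologicalSpace.NonemptyCompacts (E d))
    (x p : E d) (hp : p ∈ (K : Set (E d)))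
    (hxp : dist x p = Metric.infDist x (K : Set (E d)))
    (hd : DifferentiableAt ℝ (fun y => Metric.infDist y (K : Set (E d)) ^ 2) x) :
    p = x - (2 : ℝ)⁻¹ • (InnerProductSpace.toDual ℝ (E d)).symm
      (fderiv ℝ (fun y => Metric.infDist y (K : Set (E d)) ^ 2) x) := by
  have h1 : HasFDerivAt (fun y : E d => ‖y - p‖ ^ 2) (2 • innerSL ℝ (x - p)) x := by
    simpa using ((hasFDerivAt_id x).sub_const p).norm_sq
  have hmin : IsLocalMin
      (fun y => ‖y - p‖ ^ 2 - Metric.infDist y (K : Set (E d)) ^ 2) x := by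
    refine Filter.Eventually.of_forall fun y => ?_
    have h2 : Metric.infDist y (K : Set (E d)) ≤ ‖y - p‖ := by
      rw [← dist_eq_norm]; exact Metric.infDist_le_dist_of_mem hp
    have h3 : 0 ≤ Metric.infDist y (K : Set (E d)) := Metric.infDist_nonneg
    have h4 : ‖x - p‖ = Metric.infDist x (K : Set (E d)) := by rw [← dist_eq_norm, hxp]
    simp only [h4, sub_self]
    nlinarith
  have h5 := hmin.hasFDerivAt_eq_zero (h1.sub hd.hasFDerivAt)
  rw [← sub_eq_zero.1 h5]
  have h6 : (InnerProductSpace.toDual ℝ (E d)).symm (2 • innerSL ℝ (x - p)) =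
      (2 : ℝ) • (x - p) := by
    rw [LinearIsometryEquiv.symm_apply_eq]
    ext v
    simp
  rw [h6, smul_smul]
  norm_num

theorem ae_differentiableAt_infDist_sq {d : ℕ} (K : TopologicalSpace.NonemptyCompacts (E d)) :
    ∀ᵐ x : E d, DifferentiableAt ℝ (fun y => Metric.infDist y (K : Set (E d)) ^ 2) x := by
  filter_upwards [(Metric.lipschitz_infDist_pt (K : Set (E d))).ae_differentiableAt
    (μ := volume)] with x hx
  exact hx.pow 2

/-- Almost every point has exactly one closest point in `K`. -/
theorem ae_eq_metricProj {d : ℕ} (K : TopologicalSpace.NonemptyCompacts (E d)) :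
    ∀ᵐ x : E d, ∀ p ∈ (K : Set (E d)), dist x p = Metric.infDist x (K : Set (E d)) →
      p = metricProj K x := by
  filter_upwards [ae_differentiableAt_infDist_sq K] with x hx p hp hxp
  rw [nearest_eq_of_differentiableAt K x p hp hxp hx]
  exact (nearest_eq_of_differentiableAt K x _ (metricProj_mem K x) (dist_metricProj K x) hx).symm

theorem aemeasurable_metricProj {d : ℕ} (K : TopologicalSpace.NonemptyCompacts (E d)) :
    AEMeasurable (metricProj K) (volume : Measure (E d)) := by
  refine ⟨fun x => x - (2 : ℝ)⁻¹ • (InnerProductSpace.toDual ℝ (E d)).symm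
      (fderiv ℝ (fun y => Metric.infDist y (K : Set (E d)) ^ 2) x), ?_, ?_⟩
  · have := (InnerProductSpace.toDual ℝ (E d)).symm.continuous.measurable.comp
      (measurable_fderiv ℝ (fun y => Metric.infDist y (K : Set (E d)) ^ 2))
    exact measurable_id.sub (this.const_smul (2 : ℝ)⁻¹)
  · filter_upwards [ae_differentiableAt_infDist_sq K] with x hx
    exact nearest_eq_of_differentiableAt K x _ (metricProj_mem K x) (dist_metricProj K x) hx

/-! ### The Voronoi tensor measures -/

theorem continuous_powProd {d : ℕ} (r s : ℕ) :
    Continuous fun z : E d × E d => powProd r s z.1 z.2 := by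
  have happ : Continuous fun z : E d × E d =>
      (Fin.append (fun _ : Fin r => z.1) (fun _ : Fin s => z.2) : Fin (r + s) → E d) := by
    refine continuous_pi fun i => ?_
    refine Fin.addCases (fun j => ?_) (fun j => ?_) i
    · simpa using continuous_fst
    · simpa using continuous_snd
  have hlin : ∀ m, Continuous fun y : Fin m → E d => tensorProd y := by
    intro m
    have : (fun y : Fin m → E d => tensorProd y) = fun y =>
        ContinuousMultilinearMap.compContinuousLinearMapContinuousMultilinear ℝ
          (fun _ : Fin m => E d) (fun _ : Fin m => ℝ) ℝ (fun i => innerSL ℝ (y i))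
          (ContinuousMultilinearMap.mkPiAlgebra ℝ (Fin m) ℝ) := by
      ext y v; simp [tensorProd]
    rw [this]
    refine Continuous.clm_apply ((ContinuousMultilinearMap.compContinuousLinearMapContinuousMultilinear
      ℝ (fun _ : Fin m => E d) (fun _ : Fin m => ℝ) ℝ).cont.comp ?_) continuous_const
    exact continuous_pi fun i => (innerSL ℝ).continuous.comp (continuous_apply i)
  refine (SymTensor.toMultilinear.isometry.isEmbedding.continuous_iff).2 ?_
  change Continuous fun z : E d × E d => (((r + s).factorial : ℝ)⁻¹) •
    ∑ σ : Equiv.Perm (Fin (r + s)),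
      tensorProd (Fin.append (fun _ : Fin r => z.1) (fun _ : Fin s => z.2) ∘ σ)
  have hσ : ∀ σ : Equiv.Perm (Fin (r + s)), Continuous fun z : E d × E d =>
      (Fin.append (fun _ : Fin r => z.1) (fun _ : Fin s => z.2) ∘ σ : Fin (r + s) → E d) :=
    fun σ => continuous_pi fun i => (continuous_apply (σ i)).comp happ
  exact (continuous_finsetSum _ fun σ _ => (hlin (r + s)).comp (hσ σ)).const_smul
    (((r + s).factorial : ℝ)⁻¹)

/-- The integrand `p_K(x)^r (x - p_K(x))^s`. -/
def voronoiDensity {d : ℕ} (r s : ℕ) (K : TopologicalSpace.NonemptyCompacts (E d)) (x : E d) :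
    SymTensor d (r + s) :=
  powProd r s (metricProj K x) (x - metricProj K x)

theorem integrableOn_voronoiDensity {d : ℕ} (R : ℝ) (r s : ℕ)
    (K : TopologicalSpace.NonemptyCompacts (E d)) :
    IntegrableOn (voronoiDensity r s K) (Metric.cthickening R (K : Set (E d))) volume := by
  have hc : IsCompact (Metric.cthickening R (K : Set (E d))) := K.isCompact.cthickening
  have hp : AEMeasurable (fun x => (metricProj K x, x - metricProj K x))
      (volume : Measure (E d)) :=
    (aemeasurable_metricProj K).prodMk (aemeasurable_id.sub (aemeasurable_metricProj K))
  have hpow := continuous_powProd (d := d) r s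
  have hm := hpow.comp_aestronglyMeasurable hp.aestronglyMeasurable
  have hpair : Continuous fun z : E d × E d => (z.1, z.2 - z.1) :=
    continuous_fst.prodMk (continuous_snd.sub continuous_fst)
  have hcont := hpow.comp hpair
  obtain ⟨C, hC⟩ := (K.isCompact.prod hc).exists_bound_of_continuousOn hcont.continuousOn
  refine Measure.integrableOn_of_bounded (M := C) hc.measure_lt_top.ne hm ?_
  filter_upwards [ae_restrict_mem hc.isClosed.measurableSet] with x hx
  exact hC (metricProj K x, x) ⟨metricProj_mem K x, hx⟩

open Classical in
/-- The Voronoi tensor measure `V_R^{r,s}(K; ·)`: the `𝕋^{r+s}`-valued Borel measure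
`A ↦ ∫_{K^R} 1_A(p_K(x)) p_K(x)^r (x - p_K(x))^s dx`, where `K^R` is the closed `R`-parallel set
of `K`. -/
def voronoiMeasure {d : ℕ} (R : ℝ) (r s : ℕ) (K : TopologicalSpace.NonemptyCompacts (E d)) :
    VectorMeasure (E d) (SymTensor d (r + s)) where
  measureOf' A := if MeasurableSet A then
      ∫ x in Metric.cthickening R (K : Set (E d)),
        A.indicator (fun _ => (1 : ℝ)) (metricProj K x) • voronoiDensity r s K x
    else 0
  empty' := by simp
  not_measurable' := by intro A hA; simp [hA]
  m_iUnion' := by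
    intro A hA hdisj
    simp only [hA, MeasurableSet.iUnion hA, if_true]
    have hpre : ∀ B : Set (E d), MeasurableSet B →
        NullMeasurableSet (metricProj K ⁻¹' B)
          (volume.restrict (Metric.cthickening R (K : Set (E d)))) := fun B hB =>
      (aemeasurable_metricProj K).restrict.nullMeasurable hB
    have hset : ∀ B : Set (E d), MeasurableSet B →
        ∫ x in Metric.cthickening R (K : Set (E d)),
          B.indicator (fun _ => (1 : ℝ)) (metricProj K x) • voronoiDensity r s K x =
        ∫ x in metricProj K ⁻¹' B, voronoiDensity r s K x
          ∂(volume.restrict (Metric.cthickening R (K : Set (E d)))) := by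
      intro B hB
      rw [← integral_indicator₀ (hpre B hB)]
      congr 1
      ext1 x
      by_cases hx : metricProj K x ∈ B
      · rw [Set.indicator_of_mem hx, Set.indicator_of_mem (by exact hx), one_smul]
      · rw [Set.indicator_of_notMem hx, Set.indicator_of_notMem (by exact hx), zero_smul]
    simp only [hset _ (hA _), hset _ (MeasurableSet.iUnion hA), Set.preimage_iUnion]
    refine hasSum_integral_iUnion_ae (fun i => hpre _ (hA i)) (fun i j hij => ?_) ?_
    · exact ((hdisj hij).preimage _).aedisjoint
    · exact (integrableOn_voronoiDensity R r s K).integrable.integrableOn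

/-! ### The bounded Lipschitz distance -/

/-- The supremum norm `|f|_∞`, with value `∞` if `f` is unbounded. -/
def supNorm {d : ℕ} (f : E d → ℝ) : ℝ≥0∞ := ⨆ x, ‖f x‖ₑ

/-- The Lipschitz seminorm `|f|_L = sup {|f(x) - f(y)| / |x - y| : x ≠ y}`, with value `∞` if
`f` is not Lipschitz. -/
def lipNorm {d : ℕ} (f : E d → ℝ) : ℝ≥0∞ :=
  ⨆ (x : E d) (y : E d) (_ : x ≠ y), ‖f x - f y‖ₑ / ‖x - y‖ₑ

/-- The bounded Lipschitz norm `|f|_bL = |f|_L + |f|_∞`; it is finite exactly for the bounded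
Lipschitz functions. -/
def blNorm {d : ℕ} (f : E d → ℝ) : ℝ≥0∞ := lipNorm f + supNorm f

/-- The bounded Lipschitz distance of two `𝕋^p`-valued measures `μ` and `ν`,
`sup {|∫ f dμ - ∫ f dν| : |f|_bL ≤ 1}`. -/
def blDist {d p : ℕ} (μ ν : VectorMeasure (E d) (SymTensor d p)) : ℝ≥0∞ :=
  ⨆ (f : E d → ℝ) (_ : blNorm f ≤ 1), ‖(∫ᵛ x, f x ∂•μ) - (∫ᵛ x, f x ∂•ν)‖ₑ

end VoronoiTensor

end

/-! The function `projPotential K`, ψ_K(x) = (|x|² - d_K(x)²)/2, is a supremum of the affine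
functions ⟨x,p⟩ - |p|²/2 over p ∈ K. It is therefore convex, and p_K(x) is a subgradient of it at x
(`projPotential_add_inner_le`). On bounded sets ψ_K and ψ_{K₀} differ by O(ε), where ε = d_H(K,K₀).

Adding the subgradient inequality for one set in direction v to that for the other in direction -v
bounds |⟨p_K - p_{K₀}, v⟩| by a second difference of ψ_{K₀} plus O(ε)
(`abs_inner_metricProj_sub_le`). For |v| = h this second difference has integral O(h²) over a ball:
it is nonnegative and ψ_{K₀} is Lipschitz, so one of the two differences can be moved onto a cutoff
(`setIntegral_secondDifference_le`). Hence h ∫|p_K - p_{K₀}| = O(h² + ε), and h = √ε yields the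
exponent 1/2 (`exists_integral_norm_metricProj_sub_le`).

The domains of integration K^R and K₀^R differ by volume O(ε) only. Monotonicity of p_K makes the
contraction towards K expand back by at most a factor c, so |K^{cR}| ≤ c^d |K^R|
(`volume_cthickening_mul_le`); this is applied with cR = R + ε (`volume_cthickening_diff_le`).

By `integral_voronoiMeasure`, integrals against the Voronoi measures are Lebesgue integrals of
f(p_K) p_K^r (x - p_K)^s. These are compared pointwise on K^R ∩ K₀^R, using that the integrand is
Lipschitz in p_K, and are bounded trivially on the symmetric difference. -/

namespace VoronoiTensor

/-! ### Integration against a vector measure given by a density and an image map -/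

section VectorMeasureIntegral

open Filter Topology

variable {X Y F : Type*} [MeasurableSpace X] [MeasurableSpace Y]
  [NormedAddCommGroup F] [NormedSpace ℝ F]

/-- If `μ A = ∫ 1_A(p) D dκ` for all measurable `A`, then the variation of `μ` is at most the
image under `p` of the measure with density `‖D‖` with respect to `κ`. -/
theorem variation_le_map_withDensity {κ : Measure X} {p : X → Y} {D : X → F}
    {μ : VectorMeasure Y F} (hp : AEMeasurable p κ)
    (hμ : ∀ A, MeasurableSet A → μ A = ∫ x, A.indicator (fun _ => (1 : ℝ)) (p x) • D x ∂κ) :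
    μ.variation ≤ (κ.withDensity fun x => ‖D x‖ₑ).map p := by
  have hp' : AEMeasurable p (κ.withDensity fun x => ‖D x‖ₑ) :=
    hp.mono_ac (withDensity_absolutelyContinuous _ _)
  refine VectorMeasure.variation_le_of_forall_enorm_le fun A hA => ?_
  rw [hμ A hA, Measure.map_apply_of_aemeasurable hp' hA]
  refine (enorm_integral_le_lintegral_enorm _).trans ?_
  refine le_trans ?_ (withDensity_apply_le _ _)
  have hn : NullMeasurableSet (p ⁻¹' A) κ := hp.nullMeasurable hA
  rw [← lintegral_indicator₀ hn]
  refine lintegral_mono fun x => ?_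
  by_cases hx : p x ∈ A
  · rw [Set.indicator_of_mem hx, Set.indicator_of_mem (by exact hx), one_smul]
  · rw [Set.indicator_of_notMem hx, zero_smul, enorm_zero]
    exact zero_le

/-- Finite variation makes constants integrable against `μ`, which dominated convergence below
requires. -/
theorem isFiniteMeasure_variation_of_eq_integral {κ : Measure X} {p : X → Y} {D : X → F}
    {μ : VectorMeasure Y F} (hp : AEMeasurable p κ) (hD : Integrable D κ)
    (hμ : ∀ A, MeasurableSet A → μ A = ∫ x, A.indicator (fun _ => (1 : ℝ)) (p x) • D x ∂κ) :
    IsFiniteMeasure μ.variation := by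
  have : IsFiniteMeasure (κ.withDensity fun x => ‖D x‖ₑ) :=
    isFiniteMeasure_withDensity hD.2.ne
  exact isFiniteMeasure_of_le _ (variation_le_map_withDensity hp hμ)

theorem integrable_comp_smul_of_bounded {κ : Measure X} {p : X → Y} {D : X → F}
    (hp : AEMeasurable p κ) (hD : Integrable D κ) {f : Y → ℝ} (hf : StronglyMeasurable f)
    {C : ℝ} (hC : ∀ y, ‖f y‖ ≤ C) : Integrable (fun x => f (p x) • D x) κ :=
  hD.bdd_smul C (hf.measurable.comp_aemeasurable hp).aestronglyMeasurable
    (Eventually.of_forall fun x => hC (p x))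

variable [CompleteSpace F]

/-- For indicators this is `hμ`; both sides are additive in `g`. -/
theorem integral_simpleFunc_eq_integral_comp_smul {κ : Measure X} {p : X → Y} {D : X → F}
    {μ : VectorMeasure Y F} (hp : AEMeasurable p κ) (hD : Integrable D κ)
    (hμ : ∀ A, MeasurableSet A → μ A = ∫ x, A.indicator (fun _ => (1 : ℝ)) (p x) • D x ∂κ)
    (g : SimpleFunc Y ℝ) : (∫ᵛ y, g y ∂•μ) = ∫ x, g (p x) • D x ∂κ := by
  have hfin := isFiniteMeasure_variation_of_eq_integral hp hD hμ
  have hbdd : ∀ g : SimpleFunc Y ℝ, Integrable (fun x => g (p x) • D x) κ := fun g => by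
    obtain ⟨C, hC⟩ := g.exists_forall_norm_le
    exact integrable_comp_smul_of_bounded hp hD g.stronglyMeasurable hC
  have hint : ∀ g : SimpleFunc Y ℝ, μ.Integrable g := fun g => g.integrable_of_isFiniteMeasure
  induction g using SimpleFunc.induction with
  | const c hs =>
    rename_i s
    have h1 : ∀ y, (SimpleFunc.piecewise s hs (SimpleFunc.const Y c) (SimpleFunc.const Y 0)) y
        = s.indicator (fun _ => c) y := fun y => by
      classical
      simp [SimpleFunc.piecewise_apply, Set.indicator_apply]
    simp only [h1]
    have h2 := VectorMeasure.integral_indicator (μ := μ) (f := fun _ : Y => c)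
      (B := ContinuousLinearMap.lsmul ℝ ℝ) hs
    rw [h2]
    have h3 : ∀ x, s.indicator (fun _ => c) (p x) • D x
        = c • (s.indicator (fun _ => (1 : ℝ)) (p x) • D x) := fun x => by
      by_cases hx : p x ∈ s <;> simp [hx]
    simp only [h3]
    rw [integral_smul, ← hμ s hs]
    have : IsFiniteMeasure (μ.variation.restrict s) := inferInstance
    rw [VectorMeasure.setIntegral_const]
    simp
  | add _ hf hg =>
    rename_i f g _
    simp only [SimpleFunc.coe_add, Pi.add_apply, add_smul]
    rw [VectorMeasure.integral_fun_add (hint f) (hint g), hf, hg,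
      integral_add (hbdd f) (hbdd g)]

/-- If `μ A = ∫ 1_A(p) D dκ` for all measurable `A`, then `∫ f dμ = ∫ f(p) D dκ` for all bounded
measurable `f`. -/
theorem integral_eq_integral_comp_smul {κ : Measure X} {p : X → Y} {D : X → F}
    {μ : VectorMeasure Y F} (hp : AEMeasurable p κ) (hD : Integrable D κ)
    (hμ : ∀ A, MeasurableSet A → μ A = ∫ x, A.indicator (fun _ => (1 : ℝ)) (p x) • D x ∂κ)
    {f : Y → ℝ} (hf : StronglyMeasurable f) {C : ℝ} (hC : ∀ y, ‖f y‖ ≤ C) :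
    (∫ᵛ y, f y ∂•μ) = ∫ x, f (p x) • D x ∂κ := by
  have hfin := isFiniteMeasure_variation_of_eq_integral hp hD hμ
  -- A point of `Y` is needed to know that `C` is nonnegative.
  rcases isEmpty_or_nonempty Y with hY | ⟨⟨y₀⟩⟩
  · have : IsEmpty X := ⟨fun x => hY.elim (p x)⟩
    rw [VectorMeasure.integral_of_isEmpty, integral_of_isEmpty]
  have hC0 : 0 ≤ C := (norm_nonneg _).trans (hC y₀)
  -- Simple functions bounded by the same `C` converge to `f`; dominated convergence applies on both
  -- sides.
  have hlim : ∀ y, Tendsto (fun n => hf.approxBounded C n y) atTop (𝓝 (f y)) := fun y =>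
    hf.tendsto_approxBounded_of_norm_le (hC y)
  have hle : ∀ n y, ‖hf.approxBounded C n y‖ ≤ C := fun n y => hf.norm_approxBounded_le hC0 n y
  have h1 : Tendsto (fun n => ∫ᵛ y, hf.approxBounded C n y ∂•μ) atTop (𝓝 (∫ᵛ y, f y ∂•μ)) :=
    VectorMeasure.tendsto_integral_of_dominated_convergence (fun _ => C)
      (fun n => (hf.approxBounded C n).aestronglyMeasurable) (integrable_const C)
      (fun n => Eventually.of_forall (hle n)) (Eventually.of_forall hlim)
  have h2 : Tendsto (fun n => ∫ x, hf.approxBounded C n (p x) • D x ∂κ) atTop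
      (𝓝 (∫ x, f (p x) • D x ∂κ)) := by
    refine tendsto_integral_of_dominated_convergence (fun x => C * ‖D x‖)
      (fun n => (integrable_comp_smul_of_bounded hp hD
        (hf.approxBounded C n).stronglyMeasurable (hle n)).1)
      (hD.norm.const_mul C) (fun n => Eventually.of_forall fun x => ?_)
      (Eventually.of_forall fun x => (hlim (p x)).smul_const _)
    rw [norm_smul]
    exact mul_le_mul_of_nonneg_right (hle n _) (norm_nonneg _)
  simp only [integral_simpleFunc_eq_integral_comp_smul hp hD hμ] at h1
  exact tendsto_nhds_unique h1 h2

end VectorMeasureIntegral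

theorem integral_voronoiMeasure {d : ℕ} (R : ℝ) (r s : ℕ)
    (K : TopologicalSpace.NonemptyCompacts (E d)) {f : E d → ℝ} (hf : StronglyMeasurable f)
    {C : ℝ} (hC : ∀ y, ‖f y‖ ≤ C) :
    (∫ᵛ y, f y ∂•(voronoiMeasure R r s K)) =
      ∫ x in Metric.cthickening R (K : Set (E d)), f (metricProj K x) • voronoiDensity r s K x := by
  refine integral_eq_integral_comp_smul (aemeasurable_metricProj K).restrict
    (integrableOn_voronoiDensity R r s K) (fun A hA => ?_) hf hC
  exact if_pos hA

/-! ### Local Lipschitz and boundedness estimates for symmetric tensor products -/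

section TensorBounds

variable {d m : ℕ}

/-- The tensor product is a bounded multilinear map `Φ` of the functionals ⟨yᵢ,·⟩, evaluated at a
fixed form `P`; multilinear maps are Lipschitz on bounded sets. -/
theorem exists_norm_tensorProd_sub_le (d m : ℕ) (M : ℝ) :
    ∃ L : ℝ, 0 ≤ L ∧ ∀ y z : Fin m → E d, ‖y‖ ≤ M → ‖z‖ ≤ M →
      ‖tensorProd y - tensorProd z‖ ≤ L * ‖y - z‖ := by
  let Φ := ContinuousMultilinearMap.compContinuousLinearMapContinuousMultilinear ℝ
          (fun _ : Fin m => E d) (fun _ : Fin m => ℝ) ℝ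
  let P := ContinuousMultilinearMap.mkPiAlgebra ℝ (Fin m) ℝ
  have hΦ : ∀ y : Fin m → E d, tensorProd y = Φ (fun i => innerSL ℝ (y i)) P := fun y => by
    ext v; simp [tensorProd, Φ, P]
  have hn : ∀ y : Fin m → E d, ‖fun i => innerSL ℝ (y i)‖ = ‖y‖ := fun y => by
    have h : ∀ i, ‖innerSL ℝ (y i)‖₊ = ‖y i‖₊ := fun i => NNReal.eq (innerSL_apply_norm ℝ (y i))
    simp only [Pi.norm_def, h]
  refine ⟨‖Φ‖ * m * (max M 0) ^ (m - 1) * ‖P‖, by positivity, fun y z hy hz => ?_⟩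
  have h := Φ.norm_image_sub_le (fun i => innerSL ℝ (y i)) (fun i => innerSL ℝ (z i))
  have hsub : ((fun i => innerSL ℝ (y i)) - fun i => innerSL ℝ (z i)) =
      fun i => innerSL ℝ ((y - z) i) := by
    funext i; simp
  rw [hsub, hn, hn, hn, Fintype.card_fin] at h
  rw [hΦ, hΦ, ← sub_apply]
  calc _ ≤ ‖Φ (fun i => innerSL ℝ (y i)) - Φ (fun i => innerSL ℝ (z i))‖ * ‖P‖ :=
        ContinuousLinearMap.le_opNorm _ _
    _ ≤ (‖Φ‖ * m * (max ‖y‖ ‖z‖) ^ (m - 1) * ‖y - z‖) * ‖P‖ := by gcongr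
    _ ≤ (‖Φ‖ * m * (max M 0) ^ (m - 1) * ‖y - z‖) * ‖P‖ := by
        have : max ‖y‖ ‖z‖ ≤ max M 0 := max_le (hy.trans (le_max_left _ _)) (hz.trans (le_max_left _ _))
        gcongr
    _ = _ := by ring

theorem norm_comp_perm (y : Fin m → E d) (σ : Equiv.Perm (Fin m)) : ‖y ∘ σ‖ = ‖y‖ := by
  refine le_antisymm ((pi_norm_le_iff_of_nonneg (norm_nonneg _)).2 fun i => norm_le_pi_norm y _)
    ((pi_norm_le_iff_of_nonneg (norm_nonneg _)).2 fun i => ?_)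
  simpa using norm_le_pi_norm (y ∘ σ) (σ.symm i)

/-- Symmetrization averages over m! permutations, each preserving the sup norm of the family, so the
constant for `tensorProd` survives. -/
theorem exists_norm_symProd_sub_le (d m : ℕ) (M : ℝ) :
    ∃ L : ℝ, 0 ≤ L ∧ ∀ y z : Fin m → E d, ‖y‖ ≤ M → ‖z‖ ≤ M →
      ‖symProd y - symProd z‖ ≤ L * ‖y - z‖ := by
  obtain ⟨L, hL, h⟩ := exists_norm_tensorProd_sub_le d m M
  refine ⟨L, hL, fun y z hy hz => ?_⟩
  have h1 : SymTensor.toMultilinear (symProd y - symProd z) =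
      ((m.factorial : ℝ)⁻¹) •
        ∑ σ : Equiv.Perm (Fin m), (tensorProd (y ∘ σ) - tensorProd (z ∘ σ)) := by
    rw [Finset.sum_sub_distrib, smul_sub, map_sub]
    rfl
  rw [← SymTensor.toMultilinear.norm_map, h1, norm_smul, norm_inv, Real.norm_natCast]
  have h2 : ‖∑ σ : Equiv.Perm (Fin m), (tensorProd (y ∘ σ) - tensorProd (z ∘ σ))‖ ≤
      ∑ _σ : Equiv.Perm (Fin m), L * ‖y - z‖ := by
    refine norm_sum_le_of_le _ fun σ _ => ?_
    refine (h _ _ (by rwa [norm_comp_perm]) (by rwa [norm_comp_perm])).trans_eq ?_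
    rw [← norm_comp_perm (y - z) σ]
    rfl
  rw [Finset.sum_const, Finset.card_univ, Fintype.card_perm, Fintype.card_fin,
    nsmul_eq_mul] at h2
  have h3 : (m.factorial : ℝ) ≠ 0 := by positivity
  calc _ ≤ (m.factorial : ℝ)⁻¹ * (m.factorial * (L * ‖y - z‖)) := by gcongr
    _ = L * ‖y - z‖ := by field_simp

theorem norm_append_le (r s : ℕ) (x y : E d) {c : ℝ} (hx : ‖x‖ ≤ c) (hy : ‖y‖ ≤ c) :
    ‖(Fin.append (fun _ : Fin r => x) (fun _ : Fin s => y) : Fin (r + s) → E d)‖ ≤ c := by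
  refine (pi_norm_le_iff_of_nonneg ((norm_nonneg _).trans hx)).2 fun i => ?_
  refine Fin.addCases (fun j => ?_) (fun j => ?_) i
  · simpa using hx
  · simpa using hy

/-- The map `(x, y) ↦ x^r y^s` is Lipschitz on bounded sets. -/
theorem exists_norm_powProd_sub_le (d r s : ℕ) (M : ℝ) :
    ∃ L : ℝ, 0 ≤ L ∧ ∀ x y x' y' : E d, ‖x‖ ≤ M → ‖y‖ ≤ M → ‖x'‖ ≤ M → ‖y'‖ ≤ M →
      ‖powProd r s x y - powProd r s x' y'‖ ≤ L * max ‖x - x'‖ ‖y - y'‖ := by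
  obtain ⟨L, hL, h⟩ := exists_norm_symProd_sub_le d (r + s) M
  refine ⟨L, hL, fun x y x' y' hx hy hx' hy' => ?_⟩
  refine (h _ _ (norm_append_le r s x y hx hy) (norm_append_le r s x' y' hx' hy')).trans ?_
  refine mul_le_mul_of_nonneg_left ?_ hL
  have : (Fin.append (fun _ : Fin r => x) (fun _ : Fin s => y) : Fin (r + s) → E d) -
      Fin.append (fun _ : Fin r => x') (fun _ : Fin s => y') =
      Fin.append (fun _ : Fin r => x - x') (fun _ : Fin s => y - y') := by
    funext i
    refine Fin.addCases (fun j => ?_) (fun j => ?_) i <;> simp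
  rw [this]
  exact norm_append_le r s _ _ (le_max_left _ _) (le_max_right _ _)

/-- The map `(x, y) ↦ x^r y^s` is bounded on bounded sets. -/
theorem exists_norm_powProd_le (d r s : ℕ) (M : ℝ) :
    ∃ C : ℝ, 0 ≤ C ∧ ∀ x y : E d, ‖x‖ ≤ M → ‖y‖ ≤ M → ‖powProd r s x y‖ ≤ C := by
  obtain ⟨C, hC⟩ := ((isCompact_closedBall (0 : E d) M).prod
    (isCompact_closedBall (0 : E d) M)).exists_bound_of_continuousOn
    (continuous_powProd r s).continuousOn
  refine ⟨max C 0, le_max_right _ _, fun x y hx hy => (hC (x, y) ⟨?_, ?_⟩).trans (le_max_left _ _)⟩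
  · simpa using hx
  · simpa using hy

end TensorBounds

/-! ### The convex potential of the metric projection -/

section Projection

variable {d : ℕ}

/-- The convex function `(|x|² - d_K(x)²) / 2`, of which the metric projection is a
subgradient. -/
noncomputable def projPotential (K : TopologicalSpace.NonemptyCompacts (E d)) (x : E d) : ℝ :=
  (‖x‖ ^ 2 - Metric.infDist x (K : Set (E d)) ^ 2) / 2

/-- The point p_K(x) competes in the distance from x + v to K; expanding |x + v - p_K(x)|² gives the
subgradient inequality. -/
theorem projPotential_add_inner_le (K : TopologicalSpace.NonemptyCompacts (E d)) (x v : E d) :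
    projPotential K x + inner ℝ (metricProj K x) v ≤ projPotential K (x + v) := by
  have h1 : Metric.infDist (x + v) (K : Set (E d)) ≤ ‖x + v - metricProj K x‖ := by
    rw [← dist_eq_norm]; exact Metric.infDist_le_dist_of_mem (metricProj_mem K x)
  have h2 := pow_le_pow_left₀ Metric.infDist_nonneg h1 2
  have h3 : ‖x + v - metricProj K x‖ ^ 2 =
      ‖x + v‖ ^ 2 - 2 * inner ℝ (x + v) (metricProj K x) + ‖metricProj K x‖ ^ 2 :=
    norm_sub_sq_real _ _
  have h4 : ‖x - metricProj K x‖ ^ 2 =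
      ‖x‖ ^ 2 - 2 * inner ℝ x (metricProj K x) + ‖metricProj K x‖ ^ 2 :=
    norm_sub_sq_real _ _
  rw [inner_add_left] at h3
  rw [projPotential, projPotential, ← dist_metricProj K x, dist_eq_norm,
    real_inner_comm v (metricProj K x)]
  linarith

/-- Monotonicity of a subgradient: add the inequalities at x and at y. -/
theorem inner_metricProj_sub_nonneg (K : TopologicalSpace.NonemptyCompacts (E d)) (x y : E d) :
    0 ≤ inner ℝ (metricProj K x - metricProj K y) (x - y) := by
  have h1 := projPotential_add_inner_le K x (y - x)
  have h2 := projPotential_add_inner_le K y (x - y)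
  rw [add_sub_cancel] at h1 h2
  rw [← neg_sub x y, inner_neg_right] at h1
  rw [inner_sub_left]
  linarith

theorem projPotential_secondDifference_nonneg (K : TopologicalSpace.NonemptyCompacts (E d))
    (x v : E d) :
    0 ≤ projPotential K (x + v) - 2 * projPotential K x + projPotential K (x - v) := by
  have h1 := projPotential_add_inner_le K x v
  have h2 := projPotential_add_inner_le K x (-v)
  rw [inner_neg_right, ← sub_eq_add_neg x v] at h2
  linarith

theorem norm_metricProj_le {K : TopologicalSpace.NonemptyCompacts (E d)} {ρ : ℝ}
    (hK : (K : Set (E d)) ⊆ Metric.closedBall 0 ρ) (x : E d) : ‖metricProj K x‖ ≤ ρ := by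
  simpa using hK (metricProj_mem K x)

/-- The increment lies between the pairings of v with the subgradients at x and x + v, which have
norm at most ρ. -/
theorem abs_projPotential_sub_le {K : TopologicalSpace.NonemptyCompacts (E d)} {ρ : ℝ}
    (hK : (K : Set (E d)) ⊆ Metric.closedBall 0 ρ) (x v : E d) :
    |projPotential K (x + v) - projPotential K x| ≤ ρ * ‖v‖ := by
  have h1 := projPotential_add_inner_le K x v
  have h2 := projPotential_add_inner_le K (x + v) (-v)
  rw [add_neg_cancel_right, inner_neg_right] at h2
  have h3 : ∀ y, |inner ℝ (metricProj K y) v| ≤ ρ * ‖v‖ := fun y =>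
    (abs_real_inner_le_norm _ _).trans
      (mul_le_mul_of_nonneg_right (norm_metricProj_le hK y) (norm_nonneg v))
  have h4 := abs_le.1 (h3 x)
  have h5 := abs_le.1 (h3 (x + v))
  rw [abs_le]
  constructor <;> linarith

theorem continuous_projPotential (K : TopologicalSpace.NonemptyCompacts (E d)) :
    Continuous (projPotential K) :=
  ((continuous_norm.pow 2).sub ((Metric.continuous_infDist_pt _).pow 2)).div_const 2

theorem abs_infDist_sub_le (K K₀ : TopologicalSpace.NonemptyCompacts (E d)) (x : E d) :
    |Metric.infDist x (K : Set (E d)) - Metric.infDist x (K₀ : Set (E d))| ≤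
      Metric.hausdorffDist (K : Set (E d)) K₀ := by
  have hfin : Metric.hausdorffEDist (K : Set (E d)) K₀ ≠ ⊤ :=
    Metric.hausdorffEDist_ne_top_of_nonempty_of_bounded K.nonempty K₀.nonempty
      K.isCompact.isBounded K₀.isCompact.isBounded
  have h1 := Metric.infDist_le_infDist_add_hausdorffDist (x := x) hfin
  have h2 := Metric.infDist_le_infDist_add_hausdorffDist (x := x)
    (by rwa [Metric.hausdorffEDist_comm] : Metric.hausdorffEDist (K₀ : Set (E d)) K ≠ ⊤)
  rw [Metric.hausdorffDist_comm] at h2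
  rw [abs_le]
  constructor <;> linarith

theorem infDist_le_norm_add {K : TopologicalSpace.NonemptyCompacts (E d)} {ρ : ℝ}
    (hK : (K : Set (E d)) ⊆ Metric.closedBall 0 ρ) (x : E d) :
    Metric.infDist x (K : Set (E d)) ≤ ‖x‖ + ρ := by
  rw [← dist_metricProj K x, dist_eq_norm]
  exact (norm_sub_le _ _).trans (add_le_add_right (norm_metricProj_le hK x) _)

/-- Factor the difference of the squared distances: one factor is at most the Hausdorff distance,
the mean of the distances at most |x| + ρ. -/
theorem abs_projPotential_sub_projPotential_le {K K₀ : TopologicalSpace.NonemptyCompacts (E d)}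
    {ρ : ℝ} (hK : (K : Set (E d)) ⊆ Metric.closedBall 0 ρ)
    (hK₀ : (K₀ : Set (E d)) ⊆ Metric.closedBall 0 ρ) (x : E d) :
    |projPotential K x - projPotential K₀ x| ≤
      (‖x‖ + ρ) * Metric.hausdorffDist (K : Set (E d)) K₀ := by
  have h1 := abs_infDist_sub_le K K₀ x
  have h2 := infDist_le_norm_add hK x
  have h3 := infDist_le_norm_add hK₀ x
  have h4 : 0 ≤ Metric.infDist x (K : Set (E d)) := Metric.infDist_nonneg
  have h5 : 0 ≤ Metric.infDist x (K₀ : Set (E d)) := Metric.infDist_nonneg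
  have h6 : projPotential K x - projPotential K₀ x =
      -((Metric.infDist x (K : Set (E d)) + Metric.infDist x (K₀ : Set (E d))) / 2 *
        (Metric.infDist x (K : Set (E d)) - Metric.infDist x (K₀ : Set (E d)))) := by
    rw [projPotential, projPotential]; ring
  rw [h6, abs_neg, abs_mul, abs_of_nonneg (by linarith)]
  exact mul_le_mul (by linarith) h1 (abs_nonneg _) (by linarith)

/-- The second difference of a Lipschitz function which is convex along `v` has small integral. -/
theorem setIntegral_secondDifference_le {ψ : E d → ℝ} {L M : ℝ} {v : E d}
    (hψ : Continuous ψ) (hL : ∀ x, |ψ (x + v) - ψ x| ≤ L * ‖v‖)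
    (hconv : ∀ x, 0 ≤ ψ (x + v) - 2 * ψ x + ψ (x - v)) :
    ∫ x in Metric.closedBall (0 : E d) M, (ψ (x + v) - 2 * ψ x + ψ (x - v)) ≤
      L * ‖v‖ ^ 2 * volume.real (Metric.closedBall (0 : E d) (M + 1 + ‖v‖)) := by
  -- A 1-Lipschitz cutoff, at least 1 on the ball of radius M and zero outside that of radius M + 1.
  set χ : E d → ℝ := fun x => max 0 (M + 1 - ‖x‖) with hχ
  set G : E d → ℝ := fun x => ψ (x + v) - ψ x with hG
  have hχc : Continuous χ := by fun_prop
  have hGc : Continuous G := by fun_prop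
  have hχ0 : ∀ x, x ∉ Metric.closedBall (0 : E d) (M + 1) → χ x = 0 := fun x hx => by
    rw [mem_closedBall_zero_iff, not_le] at hx
    exact max_eq_left (by linarith)
  have hχs : HasCompactSupport χ :=
    HasCompactSupport.intro (isCompact_closedBall (0 : E d) (M + 1)) hχ0
  have hχv : HasCompactSupport fun x => χ (x + v) :=
    hχs.comp_homeomorph (Homeomorph.addRight v)
  have hGv : Continuous fun x => G (x - v) := by fun_prop
  have hD : ∀ x, ψ (x + v) - 2 * ψ x + ψ (x - v) = G x - G (x - v) := fun x => by
    simp only [hG, sub_add_cancel]; ring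
  have i1 : Integrable fun x => χ x * G x := (hχc.mul hGc).integrable_of_hasCompactSupport hχs.mul_right
  have i2 : Integrable fun x => χ x * G (x - v) :=
    (hχc.mul hGv).integrable_of_hasCompactSupport hχs.mul_right
  have i3 : Integrable fun x => χ (x + v) * G x :=
    ((hχc.comp (by fun_prop)).mul hGc).integrable_of_hasCompactSupport hχv.mul_right
  have hB : MeasurableSet (Metric.closedBall (0 : E d) M) := Metric.isClosed_closedBall.measurableSet
  have hB' : MeasurableSet (Metric.closedBall (0 : E d) (M + 1 + ‖v‖)) :=
    Metric.isClosed_closedBall.measurableSet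
  calc ∫ x in Metric.closedBall (0 : E d) M, (ψ (x + v) - 2 * ψ x + ψ (x - v))
      = ∫ x, (Metric.closedBall (0 : E d) M).indicator
          (fun x => ψ (x + v) - 2 * ψ x + ψ (x - v)) x := (integral_indicator hB).symm
    -- Only here is convexity used: nonnegativity lets the cutoff replace the indicator.
    _ ≤ ∫ x, (χ x * G x - χ x * G (x - v)) := by
        refine integral_mono_of_nonneg (Filter.Eventually.of_forall fun x => ?_) (i1.sub i2)
          (Filter.Eventually.of_forall fun x => ?_)
        · exact Set.indicator_nonneg (fun x _ => hconv x) x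
        · simp only
          rw [← mul_sub, ← hD]
          by_cases hx : x ∈ Metric.closedBall (0 : E d) M
          · rw [Set.indicator_of_mem hx]
            rw [mem_closedBall_zero_iff] at hx
            exact le_mul_of_one_le_left (hconv x) (le_max_of_le_right (by linarith))
          · rw [Set.indicator_of_notMem hx]
            exact mul_nonneg (le_max_left _ _) (hconv x)
    _ = (∫ x, χ x * G x) - ∫ x, χ x * G (x - v) := integral_sub i1 i2
    -- Discrete integration by parts: translation by v moves one difference onto χ, which gains a
    -- second factor |v|.
    _ = (∫ x, χ x * G x) - ∫ x, χ (x + v) * G x := by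
        rw [← integral_add_right_eq_self (fun x => χ x * G (x - v)) v]
        simp only [add_sub_cancel_right]
    _ = ∫ x, (χ x * G x - χ (x + v) * G x) := (integral_sub i1 i3).symm
    _ ≤ ∫ x, (Metric.closedBall (0 : E d) (M + 1 + ‖v‖)).indicator
          (fun _ => L * ‖v‖ ^ 2) x := by
        refine integral_mono (i1.sub i3) ((integrable_indicator_iff hB').2
          (integrableOn_const measure_closedBall_lt_top.ne)) fun x => ?_
        simp only
        rw [← sub_mul]
        by_cases hx : x ∈ Metric.closedBall (0 : E d) (M + 1 + ‖v‖)
        · rw [Set.indicator_of_mem hx]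
          have h1 : |χ x - χ (x + v)| ≤ ‖v‖ := by
            refine (abs_max_sub_max_le_max _ _ _ _).trans ?_
            rw [sub_self, abs_zero]
            refine max_le (norm_nonneg v) ?_
            have := abs_norm_sub_norm_le (x + v) x
            rw [add_sub_cancel_left] at this
            rwa [show M + 1 - ‖x‖ - (M + 1 - ‖x + v‖) = ‖x + v‖ - ‖x‖ by ring]
          calc (χ x - χ (x + v)) * G x ≤ |(χ x - χ (x + v)) * G x| := le_abs_self _
            _ = |χ x - χ (x + v)| * |G x| := abs_mul _ _
            _ ≤ ‖v‖ * (L * ‖v‖) := mul_le_mul h1 (hL x) (abs_nonneg _) (norm_nonneg _)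
            _ = L * ‖v‖ ^ 2 := by ring
        · rw [Set.indicator_of_notMem hx]
          rw [mem_closedBall_zero_iff, not_le] at hx
          have h1 : χ x = 0 := hχ0 x (by
            rw [mem_closedBall_zero_iff, not_le]; linarith [norm_nonneg v])
          have h2 : χ (x + v) = 0 := hχ0 _ (by
            rw [mem_closedBall_zero_iff, not_le]
            have := norm_sub_le (x + v) v
            rw [add_sub_cancel_right] at this
            linarith)
          rw [h1, h2, sub_self, zero_mul]
    _ = L * ‖v‖ ^ 2 * volume.real (Metric.closedBall (0 : E d) (M + 1 + ‖v‖)) := by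
        rw [integral_indicator hB', setIntegral_const, smul_eq_mul, mul_comm]

end Projection

/-! ### Volume of parallel sets -/

section ParallelVolume

variable {d : ℕ}

/-- Lebesgue measure is a multiple of d-dimensional Hausdorff measure, for which the bound holds
without measurability of the image. -/
theorem volume_le_of_antilipschitzWith {c : NNReal} {S : E d → E d} (hS : AntilipschitzWith c S)
    (A : Set (E d)) : volume A ≤ (c : ℝ≥0∞) ^ d * volume (S '' A) := by
  have h := hS.le_hausdorffMeasure_image (d := d) (Nat.cast_nonneg d) A
  rw [ENNReal.rpow_natCast] at h
  rw [Measure.isAddLeftInvariant_eq_smul (volume : Measure (E d)) (Measure.hausdorffMeasure d)]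
  simp only [Measure.smul_apply, ENNReal.smul_def, smul_eq_mul]
  rw [mul_left_comm]
  gcongr

/-- Pair the difference of the images with x - y: monotonicity of p_K leaves at least c⁻¹|x - y|²,
and Cauchy–Schwarz concludes. -/
theorem antilipschitzWith_contraction_metricProj (K : TopologicalSpace.NonemptyCompacts (E d))
    {c : ℝ} (hc : 1 ≤ c) :
    AntilipschitzWith c.toNNReal fun y => metricProj K y + c⁻¹ • (y - metricProj K y) := by
  have hc0 : 0 < c := zero_lt_one.trans_le hc
  refine AntilipschitzWith.of_le_mul_dist fun x y => ?_
  rw [Real.coe_toNNReal _ hc0.le, dist_eq_norm, dist_eq_norm]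
  have h1 := inner_metricProj_sub_nonneg K x y
  set w := metricProj K x + c⁻¹ • (x - metricProj K x) -
    (metricProj K y + c⁻¹ • (y - metricProj K y)) with hw
  have h2 : w = c⁻¹ • (x - y) + (1 - c⁻¹) • (metricProj K x - metricProj K y) := by
    rw [hw]; module
  have h3 : inner ℝ w (x - y) = c⁻¹ * ‖x - y‖ ^ 2 +
      (1 - c⁻¹) * inner ℝ (metricProj K x - metricProj K y) (x - y) := by
    rw [h2, inner_add_left, inner_smul_left, inner_smul_left, real_inner_self_eq_norm_sq]
    rfl
  have h4 : 0 ≤ 1 - c⁻¹ := sub_nonneg.2 (inv_le_one_of_one_le₀ hc)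
  have h5 : c⁻¹ * ‖x - y‖ ^ 2 ≤ ‖w‖ * ‖x - y‖ := by
    have := real_inner_le_norm w (x - y)
    have := mul_nonneg h4 h1
    linarith
  have h6 : ‖x - y‖ * ‖x - y‖ ≤ c * ‖w‖ * ‖x - y‖ := by
    have := mul_le_mul_of_nonneg_left h5 hc0.le
    rw [← mul_assoc, mul_inv_cancel₀ hc0.ne'] at this
    linarith
  rcases (norm_nonneg (x - y)).eq_or_lt with h | h
  · rw [← h]; positivity
  · exact le_of_mul_le_mul_right h6 h

theorem mem_cthickening_iff_infDist_le (K : TopologicalSpace.NonemptyCompacts (E d)) {R : ℝ}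
    (hR : 0 ≤ R) (x : E d) :
    x ∈ Metric.cthickening R (K : Set (E d)) ↔ Metric.infDist x (K : Set (E d)) ≤ R := by
  rw [Metric.mem_cthickening_iff, Metric.infDist,
    ENNReal.le_ofReal_iff_toReal_le (Metric.infEDist_ne_top K.nonempty) hR]

/-- Dilating the radius of a parallel set by a factor `c ≥ 1` increases its volume at most by the
factor `c ^ d`. -/
theorem volume_cthickening_mul_le (K : TopologicalSpace.NonemptyCompacts (E d)) {R c : ℝ}
    (hR : 0 ≤ R) (hc : 1 ≤ c) :
    volume.real (Metric.cthickening (c * R) (K : Set (E d))) ≤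
      c ^ d * volume.real (Metric.cthickening R (K : Set (E d))) := by
  have hc0 : 0 < c := zero_lt_one.trans_le hc
  have hfin : volume (Metric.cthickening R (K : Set (E d))) ≠ ⊤ :=
    K.isCompact.cthickening.measure_lt_top.ne
  have h1 := volume_le_of_antilipschitzWith (antilipschitzWith_contraction_metricProj K hc)
    (Metric.cthickening (c * R) (K : Set (E d)))
  have h2 : (fun y => metricProj K y + c⁻¹ • (y - metricProj K y)) ''
      Metric.cthickening (c * R) (K : Set (E d)) ⊆ Metric.cthickening R (K : Set (E d)) := by
    rintro _ ⟨y, hy, rfl⟩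
    rw [mem_cthickening_iff_infDist_le K (by positivity)] at hy
    rw [mem_cthickening_iff_infDist_le K hR]
    refine (Metric.infDist_le_dist_of_mem (metricProj_mem K y)).trans ?_
    rw [dist_eq_norm, add_sub_cancel_left, norm_smul, ← dist_eq_norm, dist_metricProj,
      Real.norm_of_nonneg (inv_nonneg.2 hc0.le)]
    exact (inv_mul_le_iff₀ hc0).2 hy
  have h3 := h1.trans (mul_le_mul_right (measure_mono h2) _)
  have h4 := ENNReal.toReal_mono (ENNReal.mul_ne_top (by simp) hfin) h3
  rw [ENNReal.toReal_mul, ENNReal.toReal_pow, ENNReal.coe_toReal, Real.coe_toNNReal _ hc0.le] at h4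
  exact h4

theorem one_add_pow_sub_one_le {t T : ℝ} (ht : 0 ≤ t) (htT : t ≤ T) (n : ℕ) :
    (1 + t) ^ n - 1 ≤ n * (1 + T) ^ n * t := by
  have h := mul_geom_sum (1 + t) n
  rw [add_sub_cancel_left] at h
  rw [← h, mul_comm]
  refine mul_le_mul_of_nonneg_right ?_ ht
  calc ∑ i ∈ Finset.range n, (1 + t) ^ i ≤ ∑ _i ∈ Finset.range n, (1 + T) ^ n :=
        Finset.sum_le_sum fun i hi => (pow_le_pow_left₀ (by linarith) (by linarith) i).trans
          (pow_le_pow_right₀ (by linarith) (Finset.mem_range.1 hi).le)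
    _ = n * (1 + T) ^ n := by simp

theorem cthickening_subset_closedBall {K : TopologicalSpace.NonemptyCompacts (E d)} {R ρ : ℝ}
    (hR : 0 ≤ R) (hK : (K : Set (E d)) ⊆ Metric.closedBall 0 ρ) :
    Metric.cthickening R (K : Set (E d)) ⊆ Metric.closedBall 0 (ρ + R) := fun x hx => by
  rw [mem_cthickening_iff_infDist_le K hR, ← dist_metricProj K x, dist_eq_norm] at hx
  rw [mem_closedBall_zero_iff]
  have h := norm_add_le (metricProj K x) (x - metricProj K x)
  rw [add_sub_cancel] at h
  linarith [norm_metricProj_le hK x]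

theorem hausdorffDist_le_two_mul {K K₀ : TopologicalSpace.NonemptyCompacts (E d)} {ρ : ℝ}
    (hK : (K : Set (E d)) ⊆ Metric.closedBall 0 ρ)
    (hK₀ : (K₀ : Set (E d)) ⊆ Metric.closedBall 0 ρ) :
    Metric.hausdorffDist (K : Set (E d)) K₀ ≤ 2 * ρ := by
  obtain ⟨a, ha⟩ := K.nonempty
  obtain ⟨b, hb⟩ := K₀.nonempty
  have hdist : ∀ x ∈ (K : Set (E d)), ∀ y ∈ (K₀ : Set (E d)), dist x y ≤ 2 * ρ := fun x hx y hy => by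
    have h1 := hK hx
    have h2 := hK₀ hy
    rw [Metric.mem_closedBall] at h1 h2
    linarith [dist_triangle_right x y 0]
  refine Metric.hausdorffDist_le_of_mem_dist (dist_nonneg.trans (hdist a ha b hb))
    (fun x hx => ⟨b, hb, hdist x hx b hb⟩) fun y hy => ⟨a, ha, ?_⟩
  rw [dist_comm]
  exact hdist a ha y hy

/-- The parallel volume is Lipschitz in the Hausdorff distance, in the sense of one-sided
differences of parallel sets. -/
theorem volume_cthickening_diff_le {K K₀ : TopologicalSpace.NonemptyCompacts (E d)} {R ρ : ℝ}
    (hR : 0 < R) (hK : (K : Set (E d)) ⊆ Metric.closedBall 0 ρ)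
    (hK₀ : (K₀ : Set (E d)) ⊆ Metric.closedBall 0 ρ) :
    volume.real (Metric.cthickening R (K : Set (E d)) \ Metric.cthickening R (K₀ : Set (E d))) ≤
      d * (1 + 2 * ρ / R) ^ d / R * volume.real (Metric.closedBall (0 : E d) (ρ + R)) *
        Metric.hausdorffDist (K : Set (E d)) K₀ := by
  set ε := Metric.hausdorffDist (K : Set (E d)) K₀ with hε
  have hε0 : 0 ≤ ε := Metric.hausdorffDist_nonneg
  have hε2 : ε ≤ 2 * ρ := hausdorffDist_le_two_mul hK hK₀
  have ht : 0 ≤ ε / R := by positivity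
  have hcR : (1 + ε / R) * R = R + ε := by field_simp
  -- The factor 1 + ε/R enlarges the radius to R + ε, enough for the parallel set of K₀ to contain
  -- that of K.
  have hsub : Metric.cthickening R (K : Set (E d)) ⊆
      Metric.cthickening ((1 + ε / R) * R) (K₀ : Set (E d)) := fun x hx => by
    rw [mem_cthickening_iff_infDist_le _ hR.le] at hx
    rw [mem_cthickening_iff_infDist_le _ (by positivity), hcR]
    have := (abs_le.1 (abs_infDist_sub_le K K₀ x)).1
    linarith
  have hsub0 : Metric.cthickening R (K₀ : Set (E d)) ⊆
      Metric.cthickening ((1 + ε / R) * R) (K₀ : Set (E d)) :=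
    Metric.cthickening_mono (by linarith) _
  have hfin : ∀ r, volume (Metric.cthickening r (K₀ : Set (E d))) ≠ ⊤ := fun r =>
    K₀.isCompact.cthickening.measure_lt_top.ne
  calc volume.real (Metric.cthickening R (K : Set (E d)) \ Metric.cthickening R (K₀ : Set (E d)))
      ≤ volume.real (Metric.cthickening ((1 + ε / R) * R) (K₀ : Set (E d)) \
          Metric.cthickening R (K₀ : Set (E d))) :=
        measureReal_mono (Set.sdiff_subset_sdiff_left hsub)
          (measure_ne_top_of_subset Set.sdiff_subset (hfin _))
    _ = volume.real (Metric.cthickening ((1 + ε / R) * R) (K₀ : Set (E d))) -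
          volume.real (Metric.cthickening R (K₀ : Set (E d))) :=
        measureReal_sdiff hsub0 Metric.isClosed_cthickening.measurableSet (hfin _)
    _ ≤ ((1 + ε / R) ^ d - 1) * volume.real (Metric.cthickening R (K₀ : Set (E d))) := by
        have := volume_cthickening_mul_le K₀ hR.le (c := 1 + ε / R) (by linarith)
        linarith
    _ ≤ (d * (1 + 2 * ρ / R) ^ d * (ε / R)) *
          volume.real (Metric.closedBall (0 : E d) (ρ + R)) := by
        refine mul_le_mul (one_add_pow_sub_one_le ht (by gcongr) d)
          (measureReal_mono (cthickening_subset_closedBall hR.le hK₀)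
            measure_closedBall_lt_top.ne) measureReal_nonneg ?_
        have : 0 ≤ 2 * ρ / R := div_nonneg (hε0.trans hε2) hR.le
        positivity
    _ = _ := by ring

end ParallelVolume

/-! ### Hölder stability of the metric projection in L¹ -/

section ProjectionL1

variable {d : ℕ}

/-- Use the inequality for K along ±v with that for K₀ along ∓v, then replace ψ_K by ψ_{K₀} at two
points, at a cost of δ each. -/
theorem abs_inner_metricProj_sub_le {K K₀ : TopologicalSpace.NonemptyCompacts (E d)} {δ : ℝ}
    (x v : E d) (h0 : |projPotential K x - projPotential K₀ x| ≤ δ)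
    (h1 : |projPotential K (x + v) - projPotential K₀ (x + v)| ≤ δ)
    (h2 : |projPotential K (x - v) - projPotential K₀ (x - v)| ≤ δ) :
    |inner ℝ (metricProj K x - metricProj K₀ x) v| ≤
      (projPotential K₀ (x + v) - 2 * projPotential K₀ x + projPotential K₀ (x - v)) + 2 * δ := by
  have a1 := projPotential_add_inner_le K x v
  have a2 := projPotential_add_inner_le K x (-v)
  have b1 := projPotential_add_inner_le K₀ x v
  have b2 := projPotential_add_inner_le K₀ x (-v)
  rw [inner_neg_right, ← sub_eq_add_neg x v] at a2 b2
  rw [abs_le] at h0 h1 h2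
  rw [inner_sub_left, abs_le]
  constructor <;> linarith

theorem norm_le_sum_abs_inner_single (x : E d) :
    ‖x‖ ≤ ∑ i, |inner ℝ x (EuclideanSpace.single i (1 : ℝ))| := by
  have h := (EuclideanSpace.basisFun (Fin d) ℝ).sum_repr x
  calc ‖x‖ = ‖∑ i, (EuclideanSpace.basisFun (Fin d) ℝ).repr x i •
        (EuclideanSpace.basisFun (Fin d) ℝ) i‖ := by rw [h]
    _ ≤ ∑ i, |inner ℝ x (EuclideanSpace.single i (1 : ℝ))| :=
      norm_sum_le_of_le _ fun i _ => by simp [norm_smul, EuclideanSpace.inner_single_right]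

theorem integrableOn_metricProj {K : TopologicalSpace.NonemptyCompacts (E d)} {A : Set (E d)}
    (hA : volume A ≠ ⊤) : IntegrableOn (metricProj K) A := by
  obtain ⟨C, hC⟩ := K.isCompact.isBounded.exists_norm_le
  exact Measure.integrableOn_of_bounded (M := C) hA (aemeasurable_metricProj K).aestronglyMeasurable
    (Filter.Eventually.of_forall fun x => hC _ (metricProj_mem K x))

/-- `L¹`-stability of the metric projection with a free step size `h`. -/
theorem mul_integral_norm_metricProj_sub_le {K K₀ : TopologicalSpace.NonemptyCompacts (E d)}
    {ρ M h : ℝ} (hh : 0 ≤ h) (hM : 0 ≤ M) (hK : (K : Set (E d)) ⊆ Metric.closedBall 0 ρ)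
    (hK₀ : (K₀ : Set (E d)) ⊆ Metric.closedBall 0 ρ) :
    h * ∫ x in Metric.closedBall (0 : E d) M, ‖metricProj K x - metricProj K₀ x‖ ≤
      d * (ρ * h ^ 2 + 2 * (M + h + ρ) * Metric.hausdorffDist (K : Set (E d)) K₀) *
        volume.real (Metric.closedBall (0 : E d) (M + 1 + h)) := by
  set ε := Metric.hausdorffDist (K : Set (E d)) K₀ with hε
  have hε0 : 0 ≤ ε := Metric.hausdorffDist_nonneg
  have hρ : 0 ≤ ρ := (norm_nonneg _).trans (norm_metricProj_le hK 0)
  set B := Metric.closedBall (0 : E d) M with hB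
  have hBfin : volume B ≠ ⊤ := measure_closedBall_lt_top.ne
  have hint : IntegrableOn (fun x => metricProj K x - metricProj K₀ x) B :=
    (integrableOn_metricProj hBfin).sub (integrableOn_metricProj hBfin)
  set e : Fin d → E d := fun i => EuclideanSpace.single i (1 : ℝ) with he
  have hnorm : ∀ i, ‖h • e i‖ = h := fun i => by
    simp [he, norm_smul, abs_of_nonneg hh]
  have hinner : ∀ i, IntegrableOn
      (fun x => |inner ℝ (metricProj K x - metricProj K₀ x) (e i)|) B := fun i =>
    (hint.inner_const (e i)).abs
  have hδ : ∀ y : E d, ‖y‖ ≤ M + h →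
      |projPotential K y - projPotential K₀ y| ≤ (M + h + ρ) * ε := fun y hy =>
    (abs_projPotential_sub_projPotential_le hK hK₀ y).trans
      (mul_le_mul_of_nonneg_right (by linarith) hε0)
  have hψ := continuous_projPotential K₀
  have hdir : ∀ i, h * ∫ x in B, |inner ℝ (metricProj K x - metricProj K₀ x) (e i)| ≤
      (ρ * h ^ 2 + 2 * (M + h + ρ) * ε) *
        volume.real (Metric.closedBall (0 : E d) (M + 1 + h)) := fun i => by
    -- The estimate is made one coordinate at a time; summing over the basis produces the factor d.
    set v := h • e i with hv
    have hc : Continuous fun x => projPotential K₀ (x + v) - 2 * projPotential K₀ x +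
        projPotential K₀ (x - v) := by fun_prop
    have i1 : IntegrableOn (fun x => projPotential K₀ (x + v) - 2 * projPotential K₀ x +
        projPotential K₀ (x - v)) B :=
      hc.continuousOn.integrableOn_compact (isCompact_closedBall _ _)
    have i2 : IntegrableOn (fun _ : E d => 2 * ((M + h + ρ) * ε)) B := integrableOn_const hBfin
    have hsd := setIntegral_secondDifference_le (M := M) hψ
      (fun x => abs_projPotential_sub_le hK₀ x v)
      (fun x => projPotential_secondDifference_nonneg K₀ x v)
    rw [hnorm] at hsd
    have hvol : volume.real B ≤ volume.real (Metric.closedBall (0 : E d) (M + 1 + h)) :=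
      measureReal_mono (Metric.closedBall_subset_closedBall (by linarith))
        measure_closedBall_lt_top.ne
    calc h * ∫ x in B, |inner ℝ (metricProj K x - metricProj K₀ x) (e i)|
        = ∫ x in B, h * |inner ℝ (metricProj K x - metricProj K₀ x) (e i)| :=
          (integral_const_mul _ _).symm
      _ ≤ ∫ x in B, ((projPotential K₀ (x + v) - 2 * projPotential K₀ x +
            projPotential K₀ (x - v)) + 2 * ((M + h + ρ) * ε)) := by
          refine setIntegral_mono_on ((hinner i).const_mul h) (i1.add i2)
            Metric.isClosed_closedBall.measurableSet fun x hx => ?_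
          rw [hB, mem_closedBall_zero_iff] at hx
          have h1 := norm_add_le x v
          have h2 := norm_sub_le x v
          rw [hnorm] at h1 h2
          have := abs_inner_metricProj_sub_le x v (hδ x (by linarith)) (hδ _ (by linarith))
            (hδ _ (by linarith))
          rwa [hv, inner_smul_right, abs_mul, abs_of_nonneg hh, ← hv] at this
      _ = (∫ x in B, (projPotential K₀ (x + v) - 2 * projPotential K₀ x +
            projPotential K₀ (x - v))) + ∫ _x in B, 2 * ((M + h + ρ) * ε) := integral_add i1 i2
      _ ≤ ρ * h ^ 2 * volume.real (Metric.closedBall (0 : E d) (M + 1 + h)) +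
            volume.real (Metric.closedBall (0 : E d) (M + 1 + h)) * (2 * ((M + h + ρ) * ε)) := by
          rw [setIntegral_const, smul_eq_mul]
          gcongr
      _ = _ := by ring
  calc h * ∫ x in B, ‖metricProj K x - metricProj K₀ x‖
      ≤ h * ∫ x in B, ∑ i, |inner ℝ (metricProj K x - metricProj K₀ x) (e i)| := by
        refine mul_le_mul_of_nonneg_left ?_ hh
        exact integral_mono hint.norm (integrable_finsetSum _ fun i _ => hinner i)
          fun x => norm_le_sum_abs_inner_single _
    _ = ∑ i, h * ∫ x in B, |inner ℝ (metricProj K x - metricProj K₀ x) (e i)| := by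
        rw [integral_finsetSum _ fun i _ => hinner i, Finset.mul_sum]
    _ ≤ ∑ _i : Fin d, (ρ * h ^ 2 + 2 * (M + h + ρ) * ε) *
          volume.real (Metric.closedBall (0 : E d) (M + 1 + h)) :=
        Finset.sum_le_sum fun i _ => hdir i
    _ = _ := by
        rw [Finset.sum_const, Finset.card_univ, Fintype.card_fin, nsmul_eq_mul]
        ring

/-- The metric projection is `1/2`-Hölder in `L¹` with respect to the Hausdorff distance. -/
theorem exists_integral_norm_metricProj_sub_le (d : ℕ) {ρ M : ℝ} (hρ : 0 ≤ ρ) (hM : 0 ≤ M) :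
    ∃ C : ℝ, 0 ≤ C ∧ ∀ K K₀ : TopologicalSpace.NonemptyCompacts (E d),
      (K : Set (E d)) ⊆ Metric.closedBall 0 ρ → (K₀ : Set (E d)) ⊆ Metric.closedBall 0 ρ →
      ∫ x in Metric.closedBall (0 : E d) M, ‖metricProj K x - metricProj K₀ x‖ ≤
        C * √(Metric.hausdorffDist (K : Set (E d)) K₀) := by
  -- An upper bound for every step √ε, since ε ≤ 2ρ; it makes the constant independent of the sets.
  set H := √(2 * ρ) with hH
  have hH0 : 0 ≤ H := Real.sqrt_nonneg _
  refine ⟨d * (ρ + 2 * (M + H + ρ)) * volume.real (Metric.closedBall (0 : E d) (M + 1 + H)),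
    by positivity, fun K K₀ hK hK₀ => ?_⟩
  set ε := Metric.hausdorffDist (K : Set (E d)) K₀ with hε
  have hε0 : 0 ≤ ε := Metric.hausdorffDist_nonneg
  -- For ε = 0 the step would vanish and could not be cancelled, but then the sets coincide.
  rcases hε0.eq_or_lt with h0 | hpos
  · have hKK : (K : Set (E d)) = K₀ :=
      (K.isCompact.isClosed.hausdorffDist_zero_iff_eq K₀.isCompact.isClosed
        (Metric.hausdorffEDist_ne_top_of_nonempty_of_bounded K.nonempty K₀.nonempty
          K.isCompact.isBounded K₀.isCompact.isBounded)).1 h0.symm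
    have : K = K₀ := SetLike.coe_injective hKK
    subst this
    simp [← h0]
  -- This choice balances h² against ε.
  set h := √ε with hh
  have hh0 : 0 < h := Real.sqrt_pos.2 hpos
  have hhH : h ≤ H := Real.sqrt_le_sqrt (hausdorffDist_le_two_mul hK hK₀)
  have hsq : ε = h ^ 2 := (Real.sq_sqrt hε0).symm
  have key := mul_integral_norm_metricProj_sub_le hh0.le hM hK hK₀
  rw [← hε] at key
  refine le_of_mul_le_mul_left (key.trans ?_) hh0
  calc d * (ρ * h ^ 2 + 2 * (M + h + ρ) * ε) *
        volume.real (Metric.closedBall (0 : E d) (M + 1 + h))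
      ≤ d * (ρ * h ^ 2 + 2 * (M + H + ρ) * ε) *
        volume.real (Metric.closedBall (0 : E d) (M + 1 + H)) := by
        have : volume.real (Metric.closedBall (0 : E d) (M + 1 + h)) ≤
            volume.real (Metric.closedBall (0 : E d) (M + 1 + H)) :=
          measureReal_mono (Metric.closedBall_subset_closedBall (by linarith))
            measure_closedBall_lt_top.ne
        gcongr
    _ = _ := by rw [hsq]; ring

end ProjectionL1

/-! ### Test functions of bounded Lipschitz norm at most one -/

section BoundedLipschitz

variable {d : ℕ} {f : E d → ℝ}

theorem norm_le_one_of_blNorm_le_one (hf : blNorm f ≤ 1) (x : E d) : ‖f x‖ ≤ 1 := by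
  have h1 : ‖f x‖ₑ ≤ 1 :=
    ((le_iSup (fun x => ‖f x‖ₑ) x).trans (self_le_add_left _ _)).trans hf
  rwa [← ofReal_norm, ENNReal.ofReal_le_one] at h1

theorem norm_sub_le_of_blNorm_le_one (hf : blNorm f ≤ 1) (x y : E d) :
    ‖f x - f y‖ ≤ ‖x - y‖ := by
  rcases eq_or_ne x y with rfl | hxy
  · simp
  have h1 : ‖f x - f y‖ₑ / ‖x - y‖ₑ ≤ 1 := by
    refine le_trans ?_ ((self_le_add_right _ _).trans hf)
    exact le_iSup_of_le x (le_iSup_of_le y (le_iSup_of_le hxy le_rfl))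
  have h2 : ‖f x - f y‖ₑ ≤ ‖x - y‖ₑ := by
    have h3 : ‖x - y‖ₑ ≠ 0 := by simpa [sub_eq_zero] using hxy
    simpa using (ENNReal.div_le_iff h3 enorm_ne_top).1 h1
  simpa [enorm_le_iff_norm_le] using h2

theorem continuous_of_blNorm_le_one (hf : blNorm f ≤ 1) : Continuous f := by
  refine (LipschitzWith.of_dist_le_mul (K := 1) fun x y => ?_).continuous
  rw [NNReal.coe_one, one_mul, dist_eq_norm, dist_eq_norm]
  exact norm_sub_le_of_blNorm_le_one hf x y

end BoundedLipschitz

/-! ### Comparison of the integrals over the two parallel sets -/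

section Stability

variable {d : ℕ}

theorem norm_voronoiDensity_le {r s : ℕ} {ρ M C : ℝ} (hM : 0 ≤ M)
    (hC : ∀ x y : E d, ‖x‖ ≤ M + ρ → ‖y‖ ≤ M + ρ → ‖powProd r s x y‖ ≤ C)
    {K : TopologicalSpace.NonemptyCompacts (E d)}
    (hK : (K : Set (E d)) ⊆ Metric.closedBall 0 ρ) {x : E d} (hx : ‖x‖ ≤ M) :
    ‖voronoiDensity r s K x‖ ≤ C := by
  have h := norm_metricProj_le hK x
  exact hC _ _ (by linarith) ((norm_sub_le _ _).trans (by linarith))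

theorem norm_voronoiDensity_sub_le {r s : ℕ} {ρ M L : ℝ} (hM : 0 ≤ M)
    (hL : ∀ x y x' y' : E d, ‖x‖ ≤ M + ρ → ‖y‖ ≤ M + ρ → ‖x'‖ ≤ M + ρ → ‖y'‖ ≤ M + ρ →
      ‖powProd r s x y - powProd r s x' y'‖ ≤ L * max ‖x - x'‖ ‖y - y'‖)
    {K K₀ : TopologicalSpace.NonemptyCompacts (E d)}
    (hK : (K : Set (E d)) ⊆ Metric.closedBall 0 ρ)
    (hK₀ : (K₀ : Set (E d)) ⊆ Metric.closedBall 0 ρ) {x : E d} (hx : ‖x‖ ≤ M) :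
    ‖voronoiDensity r s K x - voronoiDensity r s K₀ x‖ ≤
      L * ‖metricProj K x - metricProj K₀ x‖ := by
  have h := norm_metricProj_le hK x
  have h₀ := norm_metricProj_le hK₀ x
  refine (hL _ _ _ _ (by linarith) ((norm_sub_le _ _).trans (by linarith)) (by linarith)
    ((norm_sub_le _ _).trans (by linarith))).trans_eq ?_
  -- Both tensor arguments move by the same amount, since (x - p) - (x - p₀) = p₀ - p.
  rw [sub_sub_sub_cancel_left, norm_sub_rev (metricProj K₀ x), max_self]

/-- Where both parallel sets overlap, a product rule gives C from varying f and L from varying the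
tensor; elsewhere at most one integrand is present, bounded by C. -/
theorem norm_integral_voronoiDensity_sub_le {r s : ℕ} {R ρ C L : ℝ} (hR : 0 < R) (hρ : 0 ≤ ρ)
    (hC0 : 0 ≤ C) (hL0 : 0 ≤ L)
    (hC : ∀ x y : E d, ‖x‖ ≤ ρ + R + ρ → ‖y‖ ≤ ρ + R + ρ → ‖powProd r s x y‖ ≤ C)
    (hL : ∀ x y x' y' : E d, ‖x‖ ≤ ρ + R + ρ → ‖y‖ ≤ ρ + R + ρ → ‖x'‖ ≤ ρ + R + ρ →
      ‖y'‖ ≤ ρ + R + ρ → ‖powProd r s x y - powProd r s x' y'‖ ≤ L * max ‖x - x'‖ ‖y - y'‖)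
    {K K₀ : TopologicalSpace.NonemptyCompacts (E d)}
    (hK : (K : Set (E d)) ⊆ Metric.closedBall 0 ρ)
    (hK₀ : (K₀ : Set (E d)) ⊆ Metric.closedBall 0 ρ) {f : E d → ℝ} (hf : blNorm f ≤ 1) :
    ‖(∫ x in Metric.cthickening R (K : Set (E d)), f (metricProj K x) • voronoiDensity r s K x) -
      ∫ x in Metric.cthickening R (K₀ : Set (E d)),
        f (metricProj K₀ x) • voronoiDensity r s K₀ x‖ ≤
      (C + L) * (∫ x in Metric.closedBall (0 : E d) (ρ + R),
          ‖metricProj K x - metricProj K₀ x‖) +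
        C * volume.real (Metric.cthickening R (K : Set (E d)) \
          Metric.cthickening R (K₀ : Set (E d))) +
        C * volume.real (Metric.cthickening R (K₀ : Set (E d)) \
          Metric.cthickening R (K : Set (E d))) := by
  set A := Metric.cthickening R (K : Set (E d)) with hA
  set A₀ := Metric.cthickening R (K₀ : Set (E d)) with hA₀
  set B := Metric.closedBall (0 : E d) (ρ + R) with hB
  have hAm : MeasurableSet A := Metric.isClosed_cthickening.measurableSet
  have hA₀m : MeasurableSet A₀ := Metric.isClosed_cthickening.measurableSet
  have hBm : MeasurableSet B := Metric.isClosed_closedBall.measurableSet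
  have hAB : A ⊆ B := cthickening_subset_closedBall hR.le hK
  have hA₀B : A₀ ⊆ B := cthickening_subset_closedBall hR.le hK₀
  have hBfin : volume B ≠ ⊤ := measure_closedBall_lt_top.ne
  have hfc := (continuous_of_blNorm_le_one hf).stronglyMeasurable
  have hf1 := norm_le_one_of_blNorm_le_one hf
  set F : E d → SymTensor d (r + s) := fun x => f (metricProj K x) • voronoiDensity r s K x with hF
  set F₀ : E d → SymTensor d (r + s) :=
    fun x => f (metricProj K₀ x) • voronoiDensity r s K₀ x with hF₀
  have hFi : Integrable (A.indicator F) := (integrable_indicator_iff hAm).2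
    (integrable_comp_smul_of_bounded (aemeasurable_metricProj K).restrict
      (integrableOn_voronoiDensity R r s K) hfc hf1)
  have hF₀i : Integrable (A₀.indicator F₀) := (integrable_indicator_iff hA₀m).2
    (integrable_comp_smul_of_bounded (aemeasurable_metricProj K₀).restrict
      (integrableOn_voronoiDensity R r s K₀) hfc hf1)
  have hbound : ∀ x ∈ B, ‖F x‖ ≤ C ∧ ‖F₀ x‖ ≤ C := fun x hx => by
    rw [hB, mem_closedBall_zero_iff] at hx
    have h1 := norm_voronoiDensity_le (by positivity) hC hK hx
    have h2 := norm_voronoiDensity_le (by positivity) hC hK₀ hx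
    rw [hF, hF₀, norm_smul, norm_smul]
    exact ⟨(mul_le_of_le_one_left (norm_nonneg _) (hf1 _)).trans h1,
      (mul_le_of_le_one_left (norm_nonneg _) (hf1 _)).trans h2⟩
  have hdiff : ∀ x ∈ B, ‖F x - F₀ x‖ ≤ (C + L) * ‖metricProj K x - metricProj K₀ x‖ :=
      fun x hx => by
    rw [hB, mem_closedBall_zero_iff] at hx
    have h1 := norm_voronoiDensity_le (by positivity) hC hK hx
    have h2 := norm_voronoiDensity_sub_le (by positivity) hL hK hK₀ hx
    have h3 : F x - F₀ x = (f (metricProj K x) - f (metricProj K₀ x)) • voronoiDensity r s K x +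
        f (metricProj K₀ x) • (voronoiDensity r s K x - voronoiDensity r s K₀ x) := by
      rw [hF, hF₀]; module
    calc ‖F x - F₀ x‖ ≤ ‖metricProj K x - metricProj K₀ x‖ * C +
          1 * (L * ‖metricProj K x - metricProj K₀ x‖) := by
          rw [h3]
          refine norm_add_le_of_le ?_ ?_
          · rw [norm_smul]
            exact mul_le_mul (norm_sub_le_of_blNorm_le_one hf _ _) h1 (norm_nonneg _)
              (norm_nonneg _)
          · rw [norm_smul]
            exact mul_le_mul (hf1 _) h2 (norm_nonneg _) zero_le_one
      _ = _ := by ring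
  have hPi : IntegrableOn (fun x => (C + L) * ‖metricProj K x - metricProj K₀ x‖) B :=
    ((integrableOn_metricProj hBfin).sub (integrableOn_metricProj hBfin)).norm.const_mul _
  have hJi : ∀ {S T : Set (E d)}, MeasurableSet S → MeasurableSet T → S ⊆ B →
      Integrable ((S \ T).indicator fun _ => C) := fun {S T} hS hT hSB =>
    (integrable_indicator_iff (hS.diff hT)).2 (integrableOn_const
      (measure_ne_top_of_subset (Set.sdiff_subset.trans hSB) hBfin))
  have hJ : ∀ {S T : Set (E d)}, MeasurableSet S → MeasurableSet T →
      ∫ x, (S \ T).indicator (fun _ => C) x = C * volume.real (S \ T) := fun {S T} hS hT => by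
    rw [integral_indicator (hS.diff hT), setIntegral_const, smul_eq_mul, mul_comm]
  have i1 := (integrable_indicator_iff hBm).2 hPi
  have i2 := hJi hAm hA₀m hAB
  have i3 := hJi hA₀m hAm hA₀B
  rw [← integral_indicator hAm, ← integral_indicator hA₀m, ← integral_sub hFi hF₀i]
  calc ‖∫ x, (A.indicator F x - A₀.indicator F₀ x)‖
      ≤ ∫ x, (B.indicator (fun x => (C + L) * ‖metricProj K x - metricProj K₀ x‖) x +
          (A \ A₀).indicator (fun _ => C) x + (A₀ \ A).indicator (fun _ => C) x) := by
        refine norm_integral_le_of_norm_le ((i1.add i2).add i3)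
          (Filter.Eventually.of_forall fun x => ?_)
        have hCL : 0 ≤ (C + L) * ‖metricProj K x - metricProj K₀ x‖ := by positivity
        by_cases hx : x ∈ A <;> by_cases hx₀ : x ∈ A₀
        · simpa [hx, hx₀, hAB hx] using hdiff x (hAB hx)
        · simpa [hx, hx₀, hAB hx] using
            (hbound x (hAB hx)).1.trans (le_add_of_nonneg_left hCL)
        · simpa [hx, hx₀, hA₀B hx₀] using
            (hbound x (hA₀B hx₀)).2.trans (le_add_of_nonneg_left hCL)
        · simpa [hx, hx₀] using Set.indicator_nonneg (fun y _ => by positivity) x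
    _ = _ := by
        refine (integral_add (i1.add i2) i3).trans ?_
        rw [integral_add' i1 i2, integral_indicator hBm,
          integral_const_mul, hJ hAm hA₀m, hJ hA₀m hAm]

end Stability

end VoronoiTensor

/-! ### The stability theorem -/

open VoronoiTensor in
theorem theorem4p1 (d r s : ℕ) (R ρ : ℝ) (hR : 0 < R) (hρ : 0 < ρ) :
    ∃ C₂ : ℝ, 0 < C₂ ∧
      ∀ K K₀ : TopologicalSpace.NonemptyCompacts (EuclideanSpace ℝ (Fin d)),
        (K : Set (EuclideanSpace ℝ (Fin d))) ⊆ Metric.closedBall 0 ρ →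
        (K₀ : Set (EuclideanSpace ℝ (Fin d))) ⊆ Metric.closedBall 0 ρ →
        blDist (voronoiMeasure R r s K) (voronoiMeasure R r s K₀) ≤
          ENNReal.ofReal
            (C₂ * Metric.hausdorffDist (K : Set (EuclideanSpace ℝ (Fin d))) K₀ ^ (1 / 2 : ℝ)) := by
  -- For |x| ≤ ρ + R and |p_K(x)| ≤ ρ, the radius ρ + R + ρ bounds both p_K(x) and x - p_K(x).
  obtain ⟨C, hC0, hC⟩ := exists_norm_powProd_le d r s (ρ + R + ρ)
  obtain ⟨L, hL0, hL⟩ := exists_norm_powProd_sub_le d r s (ρ + R + ρ)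
  obtain ⟨P, hP0, hP⟩ := exists_integral_norm_metricProj_sub_le d hρ.le (add_pos hρ hR).le
  set V := d * (1 + 2 * ρ / R) ^ d / R * volume.real (Metric.closedBall (0 : E d) (ρ + R)) with hV
  have hV0 : 0 ≤ V := by positivity
  -- The two copies of C V √(2ρ) come from the two set differences; the 1 only ensures positivity.
  refine ⟨(C + L) * P + 2 * (C * V * √(2 * ρ)) + 1, by positivity, fun K K₀ hK hK₀ => ?_⟩
  rw [← Real.sqrt_eq_rpow]
  refine iSup₂_le fun f hf => ?_
  have hfc := (continuous_of_blNorm_le_one hf).stronglyMeasurable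
  have hf1 := norm_le_one_of_blNorm_le_one hf
  rw [← ofReal_norm, integral_voronoiMeasure R r s K hfc hf1,
    integral_voronoiMeasure R r s K₀ hfc hf1]
  refine ENNReal.ofReal_le_ofReal
    ((norm_integral_voronoiDensity_sub_le hR hρ.le hC0 hL0 hC hL hK hK₀ hf).trans ?_)
  have h1 := hP K K₀ hK hK₀
  have h2 := volume_cthickening_diff_le hR hK hK₀
  have h3 := volume_cthickening_diff_le hR hK₀ hK
  rw [Metric.hausdorffDist_comm] at h3
  set ε := Metric.hausdorffDist (K : Set (E d)) K₀ with hε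
  have hε0 : 0 ≤ ε := Metric.hausdorffDist_nonneg
  -- The volume terms are linear in ε; boundedness of ε turns them into multiples of √ε.
  have hεle : V * ε ≤ V * (√(2 * ρ) * √ε) := by
    refine mul_le_mul_of_nonneg_left ?_ hV0
    calc ε = √ε * √ε := (Real.mul_self_sqrt hε0).symm
      _ ≤ √(2 * ρ) * √ε := by
        gcongr
        exact hausdorffDist_le_two_mul hK hK₀
  have h4 := mul_le_mul_of_nonneg_left h1 (add_nonneg hC0 hL0)
  have h5 := mul_le_mul_of_nonneg_left (h2.trans hεle) hC0
  have h6 := mul_le_mul_of_nonneg_left (h3.trans hεle) hC0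
  have h7 := Real.sqrt_nonneg ε
  linarith
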